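/- **Setting.** Let $\mathcal H=\mathbb R^n$ with an inner product $\langle\cdot,\cdot\rangle$ and its norm (the dual is identified with $\mathcal H$ by the Riesz isometry). Let $\psi:\mathcal H\to\mathbb R\cup\{+\infty\}$ be proper, convex and lower semicontinuous, and let $f:\mathcal H\to\mathbb R\cup\{+\infty\}$ have open effective domain $\operatorname{dom}f$ and be continuously differentiable on it. Put $F=f+\psi$. For each $x\in\operatorname{dom} f$ let $H(x)$ be a symmetric linear operator on $\mathcal H$, and let $L\ge 0$ be such that $$\|\nabla f(y)-\nabla f(x)-H(x)(y-x)\|\le L\|x-y\|\qquad\text{for all }x,y\in\operatorname{dom}f .$$ Here $\partial\psi$ is the convex subdifferential and $\partial F$ the limiting (Mordukhovich) subdifferential. **Trial points.** For $x\in\operatorname{dom}F$ and $\lambda\ge0$ put $\widetilde F(y;x,\lambda)=f(x)+\langle\nabla f(x),y-x\rangle+\frac12\langle H(x)(y-x),y-x\rangle+\frac\lambda2\|y-x\|^2+\psi(y)$. A *trial point* $x_+(\lambda,x)$ is a point $x_+$ with $$\psi'(x_+):=-\nabla f(x)-H(x)(x_+-x)-\lambda(x_+-x)\in\partial\psi(x_+)\quad\text{and}\quad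 \widetilde F(x_+;x,\lambda)\le\widetilde F(x;x,\lambda)=F(x);$$ put $F'(x_+):=\nabla f(x_+)+\psi'(x_+)$. Assume that a trial point exists for every $\lambda\ge L$ and every $x\in\operatorname{dom}F$. **Algorithm (LeAP-SSN).** Let $\alpha\in(0,\frac12]$, $m\ge1$, $\beta\in(0,\frac{m-1}{2m}]$, $x_0\in\operatorname{dom}F$, $\Lambda_0>0$. In iteration $k$, for $j=0,1,2,\dots$ set $\lambda=2^{j}\Lambda_k$ and compute a trial point $x_+=x_+(\lambda,x_k)$ if one exists (otherwise go to the next $j$). If $$\langle F'(x_+),x_k-x_+\rangle\ge\frac\alpha\lambda\|F'(x_+)\|^2\quad\text{and}\quad F(x_k)-F(x_+)\ge\beta\lambda\|x_+-x_k\|^2,$$ then set $x_{k+1}=x_+$, $\lambda_k=\lambda$, $\Lambda_{k+1}=\lambda_k/2$ and end iteration $k$; otherwise go to the next $j$. **Partial smoothness.** A function $g:\mathcal H\to\mathbb R\cup\{+\infty\}$ is $C^2$-partly smooth at $\bar x\in\mathcal M$ relative to $\mathcal M$ if $\mathcal M$ is a $C^2$-submanifold of $\mathcal H$ around $\bar x$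 and (i) $g|_{\mathcal M}$ is $C^2$ around $\bar x$; (ii) at every point of $\mathcal M$ near $\bar x$, $g$ is subdifferentially regular and has a subgradient; (iii) the normal space $N_{\mathcal M}(\bar x)$ is the linear subspace parallel to $\operatorname{aff}\partial g(\bar x)$; (iv) $\partial g$ is continuous (inner and outer semicontinuous) at $\bar x$ relative to $\mathcal M$. **Proposition (finite time identification).** Let $(x_k)_{k\in\mathbb N}$ be an infinite sequence of iterates of the algorithm with $x_k\to x^*$ and $F(x_k)\to F(x^*)$, where $x^*$ is a global minimiser of $F$. Assume that $F$ is $C^2$-partly smooth at $x^*$ relative to $\mathcal M$ and that $0\in\operatorname{ri}\partial F(x^*)$. Then $x_k\in\mathcal M$ for all sufficiently large $k$. If, in addition, $H(x_k)\succeq0$ for all sufficiently large $k$, the Polyak–Łojasiewicz inequality $$\frac1{2\mu}\operatorname{dist}(0,\partial F(x))^2\ge F(x)-\min F\qquad\text{for all }x\in\operatorname{dom}F$$ holds for some $\mu>0$ (with $\operatorname{dist}(0,\emptyset)=+\infty$), and for some $R>0$ the gradient $\nabla f$ is Lipschitz on the part of the open ball of radius $R$ around $x^*$ in $\operatorname{dom}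 f$ and $H$ is bounded in operator norm on the part of the closed ball of radius $R$ around $x^*$ in $\operatorname{dom} f$, then for all sufficiently large $k$ a trial point $x_+(\lambda_k/2,x_k)$ exists and every such trial point lies in $\mathcal M$. -/

import Mathlib

open Filter Topology
open scoped InnerProductSpace NNReal ENNReal

noncomputable section

namespace LeAPSSN

/-! Extended-valued functions `E → ℝ ∪ {+∞}` are functions `E → EReal` that never take the value
`⊥`.  The dual of the finite-dimensional Hilbert space `E` is identified with `E` through the Riesz
isometry, so derivatives are gradients, subgradients are vectors, the duality pairing is the inner
product, and the Riesz map is the identity. -/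

section Calculus

variable {E : Type*} [NormedAddCommGroup E] [InnerProductSpace ℝ E]

/-- Effective domain. -/
def effDom (G : E → EReal) : Set E := {x | G x < ⊤}

/-- `ψ : E → ℝ ∪ {+∞}` is proper, convex (its epigraph is convex) and lower semicontinuous. -/
structure ProperConvexLsc (ψ : E → EReal) : Prop where
  ne_bot : ∀ x, ψ x ≠ ⊥
  proper : (effDom ψ).Nonempty
  convex : Convex ℝ {p : E × ℝ | ψ p.1 ≤ (p.2 : EReal)}
  lsc : LowerSemicontinuous ψ

/-- The convex subdifferential: `h ∈ ∂ψ(x)` iff `x ∈ dom ψ` and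
`ψ(x) + ⟨h, y - x⟩ ≤ ψ(y)` for all `y`. -/
def convexSubdiff (ψ : E → EReal) (x : E) : Set E :=
  {h | x ∈ effDom ψ ∧ ∀ y, ψ x + ((⟪h, y - x⟫_ℝ : ℝ) : EReal) ≤ ψ y}

/-- The Fréchet subdifferential at a point of the effective domain:
`liminf_{u → x} (G(u) - G(x) - ⟨g, u - x⟩) / ‖u - x‖ ≥ 0`, with the division cleared. -/
def frechetSubdiff (G : E → EReal) (x : E) : Set E :=
  {g | x ∈ effDom G ∧ ∀ ε : ℝ, 0 < ε → ∀ᶠ u in 𝓝 x,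
    G x + ((⟪g, u - x⟫_ℝ - ε * ‖u - x‖ : ℝ) : EReal) ≤ G u}

/-- The limiting (Mordukhovich) subdifferential. -/
def limitingSubdiff (G : E → EReal) (x : E) : Set E :=
  {p | x ∈ effDom G ∧ ∃ (u : ℕ → E) (q : ℕ → E), (∀ k, q k ∈ frechetSubdiff G (u k)) ∧
    Tendsto u atTop (𝓝 x) ∧ Tendsto q atTop (𝓝 p) ∧
    Tendsto (fun k => G (u k)) atTop (𝓝 (G x))}

/-- The regular (Fréchet) normal cone to `C` at `x`. -/
def frechetNormalCone (C : Set E) (x : E) : Set E :=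
  {v | x ∈ C ∧ ∀ ε : ℝ, 0 < ε → ∀ᶠ u in 𝓝[C] x, ⟪v, u - x⟫_ℝ ≤ ε * ‖u - x‖}

/-- The limiting normal cone to `C` at `x`. -/
def limitingNormalCone (C : Set E) (x : E) : Set E :=
  {v | x ∈ C ∧ ∃ (u : ℕ → E) (w : ℕ → E), (∀ k, w k ∈ frechetNormalCone C (u k)) ∧
    Tendsto u atTop (𝓝 x) ∧ Tendsto w atTop (𝓝 v)}

/-- Clarke regularity of a set at one of its points: the set is locally closed there, and every
limiting normal is a regular normal. -/
def ClarkeRegularAt (C : Set E) (x : E) : Prop :=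
  x ∈ C ∧ (∃ V ∈ 𝓝 x, IsClosed V ∧ IsClosed (C ∩ V)) ∧
    limitingNormalCone C x = frechetNormalCone C x

/-- The epigraph, as a subset of the Hilbert space `E × ℝ`. -/
def epigraph (G : E → EReal) : Set (WithLp 2 (E × ℝ)) :=
  {p | G p.fst ≤ (p.snd : EReal)}

/-- Subdifferential regularity of `G` at `x`: `G(x)` is finite and the epigraph is Clarke regular
at `(x, G(x))`. -/
def SubdiffRegularAt (G : E → EReal) (x : E) : Prop :=
  G x ≠ ⊥ ∧ G x ≠ ⊤ ∧ ClarkeRegularAt (epigraph G) (WithLp.toLp 2 (x, (G x).toReal))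

/-- `S` is a `C²`-submanifold around its point `x`: a `C²`-diffeomorphism from a neighbourhood of
`x` onto an open set straightens `S` to a linear subspace. -/
def IsC2SubmanifoldAt (S : Set E) (x : E) : Prop :=
  x ∈ S ∧ ∃ (e : OpenPartialHomeomorph E E) (V : Submodule ℝ E), x ∈ e.source ∧
    ContDiffOn ℝ 2 e e.source ∧ ContDiffOn ℝ 2 e.symm e.target ∧
    e '' (e.source ∩ S) = e.target ∩ (V : Set E)

/-- Tangent vectors to `S` at `x`: velocities at `x` of `C¹` curves that run in `S`. -/
def tangentVectors (S : Set E) (x : E) : Set E :=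
  {v | ∃ γ : ℝ → E, γ 0 = x ∧ (∀ᶠ t in 𝓝 (0 : ℝ), γ t ∈ S) ∧ ContDiffAt ℝ 1 γ 0 ∧
    HasDerivAt γ v 0}

/-- The normal space to `S` at `x`: the vectors orthogonal to all tangent vectors. -/
def normalSpace (S : Set E) (x : E) : Set E :=
  {v | ∀ w ∈ tangentVectors S x, ⟪v, w⟫_ℝ = 0}

/-- A set-valued map is continuous at `x` relative to `S` (in the sense of Painlevé and
Kuratowski): it is outer semicontinuous and inner semicontinuous there. -/
def SetContinuousAtRel (T : E → Set E) (S : Set E) (x : E) : Prop :=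
  (∀ (u : ℕ → E) (q : ℕ → E) (p : E), (∀ k, u k ∈ S) → (∀ k, q k ∈ T (u k)) →
    Tendsto u atTop (𝓝 x) → Tendsto q atTop (𝓝 p) → p ∈ T x) ∧
  (∀ p ∈ T x, ∀ ε : ℝ, 0 < ε → ∀ᶠ u in 𝓝[S] x, ∃ q ∈ T u, ‖q - p‖ < ε)

/-- `G` is `C²`-partly smooth at `x` relative to `S`. -/
structure PartlySmoothAt (G : E → EReal) (S : Set E) (x : E) : Prop where
  manifold : IsC2SubmanifoldAt S x
  /-- restricted smoothness: near `x`, `G` agrees on `S` with a `C²` function -/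
  restricted_smooth : ∃ h : E → ℝ, ContDiffAt ℝ 2 h x ∧ ∀ᶠ y in 𝓝[S] x, G y = (h y : EReal)
  /-- regularity, and existence of a subgradient, at the points of `S` near `x` -/
  regular : ∀ᶠ y in 𝓝[S] x, SubdiffRegularAt G y ∧ (limitingSubdiff G y).Nonempty
  /-- normal sharpness: the normal space is the subspace parallel to the subdifferential -/
  normal_sharp : normalSpace S x =
    ((affineSpan ℝ (limitingSubdiff G x)).direction : Set E)
  /-- continuity of the subdifferential relative to `S` -/
  subgradient_continuous : SetContinuousAtRel (limitingSubdiff G) S x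

/-- The Polyak–Łojasiewicz inequality on `dom F` with constant `μ`:
`dist(0, ∂F(x))² / (2μ) ≥ F(x) - min F`.  The distance to the empty set is `+∞`. -/
def PLCondition (F : E → EReal) (μ : ℝ) : Prop :=
  ∀ x ∈ effDom F, F x ≤ (⨅ y, F y) +
    ((ENNReal.ofReal (1 / (2 * μ)) * Metric.infEDist (0 : E) (limitingSubdiff F x) ^ 2 : ℝ≥0∞) :
      EReal)

end Calculus

section Algorithm

variable {E : Type*} [NormedAddCommGroup E] [InnerProductSpace ℝ E] [CompleteSpace E]

/-- The gradient of an extended-valued function (meaningful on the interior of `dom f`). -/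
def grad (f : E → EReal) (x : E) : E := gradient (fun y => (f y).toReal) x

/-- `f : E → ℝ ∪ {+∞}` is continuously Fréchet differentiable on `dom f`, which is open. -/
structure SmoothOnDom (f : E → EReal) : Prop where
  ne_bot : ∀ x, f x ≠ ⊥
  isOpen : IsOpen (effDom f)
  contDiffOn : ContDiffOn ℝ 1 (fun y => (f y).toReal) (effDom f)

/-- The objective `F = f + ψ`. -/
def objective (f ψ : E → EReal) (x : E) : EReal := f x + ψ x

/-- On `dom f` the operators `H(x)` are symmetric and
`‖∇f(y) - ∇f(x) - H(x)(y - x)‖ ≤ L ‖x - y‖`. -/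
def MainInequality (f : E → EReal) (H : E → E →L[ℝ] E) (L : ℝ) : Prop :=
  0 ≤ L ∧ (∀ x ∈ effDom f, ∀ u v, ⟪H x u, v⟫_ℝ = ⟪u, H x v⟫_ℝ) ∧
    ∀ x ∈ effDom f, ∀ y ∈ effDom f, ‖grad f y - grad f x - H x (y - x)‖ ≤ L * ‖x - y‖

/-- The regularised model at `x` with parameter `lam`, as a function of `y`. -/
def model (f ψ : E → EReal) (H : E → E →L[ℝ] E) (lam : ℝ) (x y : E) : EReal :=
  f x + ((⟪grad f x, y - x⟫_ℝ + 1 / 2 * ⟪H x (y - x), y - x⟫_ℝ + lam / 2 * ‖y - x‖ ^ 2 : ℝ) :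
    EReal) + ψ y

/-- `z` is a trial point `x₊(lam, x)`: a stationary point of the model (first-order condition)
at which the model is not larger than at `x`. -/
structure IsTrialPoint (f ψ : E → EReal) (H : E → E →L[ℝ] E) (lam : ℝ) (x z : E) : Prop where
  first_order : -grad f x - H x (z - x) - lam • (z - x) ∈ convexSubdiff ψ z
  model_le : model f ψ H lam x z ≤ model f ψ H lam x x

/-- For every `lam ≥ L` and every `x ∈ dom F` there is a trial point. -/
def SubproblemSolvable (f ψ : E → EReal) (H : E → E →L[ℝ] E) (L : ℝ) : Prop :=
  ∀ lam : ℝ, L ≤ lam → ∀ x ∈ effDom (objective f ψ), ∃ z, IsTrialPoint f ψ H lam x z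

/-- The subgradient `F'(z) = ∇f(z) + ψ'(z)` of the objective at a trial point, where
`ψ'(z) = -∇f(x) - H(x)(z - x) - lam (z - x)`. -/
def trialSubgrad (f : E → EReal) (H : E → E →L[ℝ] E) (lam : ℝ) (x z : E) : E :=
  grad f z + (-grad f x - H x (z - x) - lam • (z - x))

/-- The two acceptance conditions for a trial point `z` computed from `x` with `lam`:
`⟨F'(z), x - z⟩ ≥ (α / lam) ‖F'(z)‖²` and `F(x) - F(z) ≥ β lam ‖z - x‖²`. -/
structure Accepted (f ψ : E → EReal) (H : E → E →L[ℝ] E) (α β lam : ℝ) (x z : E) : Prop where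
  subgrad_cond : α / lam * ‖trialSubgrad f H lam x z‖ ^ 2 ≤ ⟪trialSubgrad f H lam x z, x - z⟫_ℝ
  decrease_cond : objective f ψ z + ((β * lam * ‖z - x‖ ^ 2 : ℝ) : EReal) ≤ objective f ψ x

/-- `x` is a sequence of iterates of the method LeAP-SSN, with accepted regularisation parameters
`lam k = 2 ^ (j k) * Lam k`, where `Lam k` is the first parameter tried in iteration `k` and `j k`
is the number of unsuccessful trials there: a trial with parameter `2 ^ i * Lam k` is unsuccessful
if no trial point exists, or if the trial point that has been computed is not accepted. -/
structure IsRun (f ψ : E → EReal) (H : E → E →L[ℝ] E) (α β m : ℝ)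
    (x : ℕ → E) (lam Lam : ℕ → ℝ) (j : ℕ → ℕ) : Prop where
  alpha_pos : 0 < α
  alpha_le : α ≤ 1 / 2
  one_le_m : 1 ≤ m
  beta_pos : 0 < β
  beta_le : β ≤ (m - 1) / (2 * m)
  start_mem : x 0 ∈ effDom (objective f ψ)
  Lam_zero_pos : 0 < Lam 0
  lam_eq : ∀ k, lam k = 2 ^ j k * Lam k
  Lam_succ : ∀ k, Lam (k + 1) = lam k / 2
  trial : ∀ k, IsTrialPoint f ψ H (lam k) (x k) (x (k + 1))
  accepted : ∀ k, Accepted f ψ H α β (lam k) (x k) (x (k + 1))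
  rejected : ∀ k, ∀ i < j k,
    (¬ ∃ z, IsTrialPoint f ψ H (2 ^ i * Lam k) (x k) z) ∨
      ∃ z, IsTrialPoint f ψ H (2 ^ i * Lam k) (x k) z ∧
        ¬ Accepted f ψ H α β (2 ^ i * Lam k) (x k) z

end Algorithm

end LeAPSSN

end

/-!
Write `F = f + ψ`, and let `x*` be the limit.  Both parts rest on one identification principle
(`exists_identification_radius`): a point `u` close to `x*` with a small subgradient `∇f(u) + g`,
`g ∈ ∂ψ(u)`, lies in `M`.  If points `u_k ∉ M` violated this, let `p_k` be nearest to `u_k` in `M`.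
The unit vectors along `u_k - p_k` accumulate at some `n` normal to `M` at `x*`, and since `0` is in
the relative interior of `∂F(x*)`, which spans the normal space, some `ε n` with `ε > 0` belongs to
`∂F(x*)`.  Inner semicontinuity gives subgradients of `F` at `p_k` close to `ε n`; subtracting `∇f`,
which is continuous, turns them into subgradients of `ψ`, and monotonicity of `∂ψ` along `u_k - p_k`
yields `-ε ≥ 0` in the limit.

It remains to produce small subgradients.  Near `x*` the main inequality makes `H` bounded, so for
large parameters trial points stay near `x*`, where `dom f` contains a ball and the descent
inequality holds; hence they are accepted (`eventually_forall_accepted`) and the accepted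
parameters `λ_k` are bounded.  The main inequality then gives
`‖F'(x_{k+1})‖ ≤ (L + λ_k) ‖x_{k+1} - x_k‖`, which tends to zero.

For the trial points with parameter `λ_k / 2` and `H(x_k) ⪰ 0`, the model is strongly convex, so a
trial point `z` exists, and strong monotonicity gives `(λ_k / 2) ‖z - x_k‖ ≤ ‖F'(x_k)‖`.  The first
acceptance condition bounds `‖F'(x_k)‖` by `(λ_{k-1} / α) ‖x_k - x_{k-1}‖`, and
`λ_k ≥ λ_{k-1} / 2`, so that `‖z - x_k‖ ≤ (4 / α) ‖x_k - x_{k-1}‖` even if `λ_k → 0`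
(`IsRun.norm_sub_le_of_half`).  Thus `z` is close to `x*`, its subgradient is small, and the
identification principle applies again.
-/

namespace LeAPSSN

/-! ### Convex and limiting subgradients -/

section Subgradients

variable {E : Type*} [NormedAddCommGroup E] [InnerProductSpace ℝ E]

theorem ProperConvexLsc.coe_toReal {ψ : E → EReal} (hψ : ProperConvexLsc ψ) {x : E}
    (hx : x ∈ effDom ψ) : ((ψ x).toReal : EReal) = ψ x :=
  EReal.coe_toReal (ne_of_lt hx) (hψ.ne_bot x)

theorem SmoothOnDom.coe_toReal [CompleteSpace E] {f : E → EReal} (hf : SmoothOnDom f) {x : E}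
    (hx : x ∈ effDom f) : ((f x).toReal : EReal) = f x :=
  EReal.coe_toReal (ne_of_lt hx) (hf.ne_bot x)

theorem mem_effDom_objective [CompleteSpace E] {f ψ : E → EReal} (hf : SmoothOnDom f)
    (hψ : ProperConvexLsc ψ) {x : E} :
    x ∈ effDom (objective f ψ) ↔ x ∈ effDom f ∧ x ∈ effDom ψ := by
  constructor
  · intro h
    have h' : f x + ψ x < ⊤ := h
    change f x < ⊤ ∧ ψ x < ⊤
    refine ⟨Ne.lt_top fun h1 => ?_, Ne.lt_top fun h1 => ?_⟩
    · rw [h1, EReal.top_add_of_ne_bot (hψ.ne_bot x)] at h'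
      exact lt_irrefl _ h'
    · rw [h1, EReal.add_top_of_ne_bot (hf.ne_bot x)] at h'
      exact lt_irrefl _ h'
  · rintro ⟨h1, h2⟩
    exact EReal.add_lt_top (ne_of_lt h1) (ne_of_lt h2)

theorem objective_eq_coe [CompleteSpace E] {f ψ : E → EReal} (hf : SmoothOnDom f)
    (hψ : ProperConvexLsc ψ) {x : E} (h1 : x ∈ effDom f) (h2 : x ∈ effDom ψ) :
    objective f ψ x = (((f x).toReal + (ψ x).toReal : ℝ) : EReal) := by
  rw [EReal.coe_add, hf.coe_toReal h1, hψ.coe_toReal h2, objective]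

theorem SmoothOnDom.hasGradientAt [CompleteSpace E] {f : E → EReal} (hf : SmoothOnDom f) {x : E}
    (hx : x ∈ effDom f) : HasGradientAt (fun y => (f y).toReal) (grad f x) x :=
  ((hf.contDiffOn.differentiableOn one_ne_zero x hx).differentiableAt
    (hf.isOpen.mem_nhds hx)).hasGradientAt

theorem SmoothOnDom.continuousAt_grad [CompleteSpace E] {f : E → EReal} (hf : SmoothOnDom f)
    {x : E} (hx : x ∈ effDom f) : ContinuousAt (grad f) x := by
  have h := (hf.contDiffOn.continuousOn_fderiv_of_isOpen hf.isOpen le_rfl).continuousAt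
    (hf.isOpen.mem_nhds hx)
  exact (InnerProductSpace.toDual ℝ E).symm.continuous.continuousAt.comp h

theorem ProperConvexLsc.le_segment {ψ : E → EReal} (hψ : ProperConvexLsc ψ) {x y : E}
    (hx : x ∈ effDom ψ) (hy : y ∈ effDom ψ) {t : ℝ} (h0 : 0 ≤ t) (h1 : t ≤ 1) :
    ψ (x + t • (y - x)) ≤ (((1 - t) * (ψ x).toReal + t * (ψ y).toReal : ℝ) : EReal) := by
  have h := hψ.convex (x := (x, (ψ x).toReal)) (y := (y, (ψ y).toReal))
    (by simp [hψ.coe_toReal hx]) (by simp [hψ.coe_toReal hy])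
    (sub_nonneg.2 h1) h0 (by ring)
  have e : x + t • (y - x) = (1 - t) • x + t • y := by module
  rw [e]
  exact h

theorem inner_add_le_of_mem_convexSubdiff {ψ : E → EReal} (hψ : ProperConvexLsc ψ) {x y g : E}
    (hg : g ∈ convexSubdiff ψ x) (hy : y ∈ effDom ψ) :
    (ψ x).toReal + ⟪g, y - x⟫_ℝ ≤ (ψ y).toReal := by
  have h := hg.2 y
  rw [← hψ.coe_toReal hg.1, ← hψ.coe_toReal hy] at h
  exact_mod_cast h

/-- The convex subdifferential is a monotone operator. -/
theorem convexSubdiff_monotone {ψ : E → EReal} (hψ : ProperConvexLsc ψ) {x y g h : E}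
    (hg : g ∈ convexSubdiff ψ x) (hh : h ∈ convexSubdiff ψ y) : 0 ≤ ⟪g - h, x - y⟫_ℝ := by
  have h1 := inner_add_le_of_mem_convexSubdiff hψ hg hh.1
  have h2 := inner_add_le_of_mem_convexSubdiff hψ hh hg.1
  have e : ⟪g, y - x⟫_ℝ = -⟪g, x - y⟫_ℝ := by rw [← inner_neg_right, neg_sub]
  rw [inner_sub_left]
  linarith

/-- For a convex function, the local lower bound that defines Fréchet subgradients is global. -/
theorem frechetSubdiff_subset_convexSubdiff {ψ : E → EReal} (hψ : ProperConvexLsc ψ) (x : E) :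
    frechetSubdiff ψ x ⊆ convexSubdiff ψ x := by
  rintro g ⟨hx, hg⟩
  refine ⟨hx, fun y => ?_⟩
  by_cases hy : y ∈ effDom ψ
  swap
  · have : ψ y = ⊤ := not_lt_top_iff.1 hy
    rw [this]
    exact le_top
  have key : ∀ ε : ℝ, 0 < ε → (ψ x).toReal + ⟪g, y - x⟫_ℝ ≤ (ψ y).toReal + ε * ‖y - x‖ := by
    intro ε hε
    have hc : Tendsto (fun t : ℝ => x + t • (y - x)) (𝓝[>] 0) (𝓝 x) := by
      have : Tendsto (fun t : ℝ => x + t • (y - x)) (𝓝 0) (𝓝 (x + (0 : ℝ) • (y - x))) :=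
        Continuous.tendsto (by fun_prop) 0
      rw [zero_smul, add_zero] at this
      exact this.mono_left nhdsWithin_le_nhds
    have h1 : ∀ᶠ t : ℝ in 𝓝[>] 0, t ≤ 1 :=
      nhdsWithin_le_nhds (Iic_mem_nhds one_pos)
    obtain ⟨t, ⟨ht, ht1⟩, ht0⟩ :=
      (((hc.eventually (hg ε hε)).and h1).and self_mem_nhdsWithin).exists
    have ht0 : 0 < t := ht0
    have h2 := ht.trans (hψ.le_segment hx hy ht0.le ht1)
    rw [← hψ.coe_toReal hx, add_sub_cancel_left, inner_smul_right, norm_smul,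
      Real.norm_of_nonneg ht0.le] at h2
    have h3 : (ψ x).toReal + (t * ⟪g, y - x⟫_ℝ - ε * (t * ‖y - x‖)) ≤
      (1 - t) * (ψ x).toReal + t * (ψ y).toReal := by exact_mod_cast h2
    refine le_of_mul_le_mul_left ?_ ht0
    linarith
  have h : (ψ x).toReal + ⟪g, y - x⟫_ℝ ≤ (ψ y).toReal := by
    have hc : Tendsto (fun ε : ℝ => (ψ y).toReal + ε * ‖y - x‖) (𝓝[>] 0)
        (𝓝 ((ψ y).toReal + 0 * ‖y - x‖)) :=
      (Continuous.tendsto (by fun_prop) 0).mono_left nhdsWithin_le_nhds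
    rw [zero_mul, add_zero] at hc
    exact ge_of_tendsto hc (eventually_mem_nhdsWithin.mono fun ε hε => key ε hε)
  rw [← hψ.coe_toReal hx, ← hψ.coe_toReal hy]
  exact_mod_cast h

theorem sub_grad_mem_frechetSubdiff [CompleteSpace E] {f ψ : E → EReal} (hf : SmoothOnDom f)
    (hψ : ProperConvexLsc ψ) {x q : E} (hq : q ∈ frechetSubdiff (objective f ψ) x) :
    q - grad f x ∈ frechetSubdiff ψ x := by
  obtain ⟨hx, hq⟩ := hq
  obtain ⟨hxf, hxψ⟩ := (mem_effDom_objective hf hψ).1 hx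
  refine ⟨hxψ, fun ε hε => ?_⟩
  have hd := (hasGradientAt_iff_isLittleO.1 (hf.hasGradientAt hxf)).bound (half_pos hε)
  filter_upwards [hq (ε / 2) (half_pos hε), hd, hf.isOpen.mem_nhds hxf] with u h1 h2 huf
  by_cases hu : u ∈ effDom ψ
  swap
  · have : ψ u = ⊤ := not_lt_top_iff.1 hu
    rw [this]
    exact le_top
  rw [objective_eq_coe hf hψ hxf hxψ, objective_eq_coe hf hψ huf hu] at h1
  rw [← hψ.coe_toReal hxψ, ← hψ.coe_toReal hu]
  have h3 : (f x).toReal + (ψ x).toReal + (⟪q, u - x⟫_ℝ - ε / 2 * ‖u - x‖) ≤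
    (f u).toReal + (ψ u).toReal := by exact_mod_cast h1
  have h4 := (le_abs_self _).trans h2
  have h5 : (ψ x).toReal + (⟪q - grad f x, u - x⟫_ℝ - ε * ‖u - x‖) ≤ (ψ u).toReal := by
    rw [inner_sub_left]
    linarith
  exact_mod_cast h5

/-- One half of the sum rule `∂F = ∇f + ∂ψ`: it passes from Fréchet to limiting subgradients since
`∇f` is continuous and `ψ` is lower semicontinuous. -/
theorem sub_grad_mem_convexSubdiff [CompleteSpace E] {f ψ : E → EReal} (hf : SmoothOnDom f)
    (hψ : ProperConvexLsc ψ) {x p : E} (hp : p ∈ limitingSubdiff (objective f ψ) x) :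
    p - grad f x ∈ convexSubdiff ψ x := by
  obtain ⟨hx, u, q, hq, hu, hqp, -⟩ := hp
  obtain ⟨hxf, hxψ⟩ := (mem_effDom_objective hf hψ).1 hx
  have hs : ∀ k, q k - grad f (u k) ∈ convexSubdiff ψ (u k) := fun k =>
    frechetSubdiff_subset_convexSubdiff hψ _ (sub_grad_mem_frechetSubdiff hf hψ (hq k))
  refine ⟨hxψ, fun y => ?_⟩
  by_cases hy : y ∈ effDom ψ
  swap
  · have : ψ y = ⊤ := not_lt_top_iff.1 hy
    rw [this]
    exact le_top
  have hlim : Tendsto (fun k => (ψ y).toReal - ⟪q k - grad f (u k), y - u k⟫_ℝ) atTop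
      (𝓝 ((ψ y).toReal - ⟪p - grad f x, y - x⟫_ℝ)) :=
    tendsto_const_nhds.sub (Tendsto.inner
      (hqp.sub ((hf.continuousAt_grad hxf).tendsto.comp hu)) (tendsto_const_nhds.sub hu))
  have hlimE := (continuous_coe_real_ereal.tendsto _).comp hlim
  have hle : ψ x ≤ (((ψ y).toReal - ⟪p - grad f x, y - x⟫_ℝ : ℝ) : EReal) := by
    refine le_of_forall_lt fun a ha => lt_of_not_ge fun hcon => ?_
    obtain ⟨b, hab, hb⟩ := exists_between ha
    obtain ⟨k, hk1, hk2⟩ :=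
      ((hu.eventually (hψ.lsc x b hb)).and (hlimE.eventually (gt_mem_nhds
        (lt_of_le_of_lt hcon hab)))).exists
    have h1 := inner_add_le_of_mem_convexSubdiff hψ (hs k) hy
    have h2 : ((ψ (u k)).toReal : EReal) ≤
        (((ψ y).toReal - ⟪q k - grad f (u k), y - u k⟫_ℝ : ℝ) : EReal) := by
      exact_mod_cast (by linarith)
    rw [hψ.coe_toReal (hs k).1] at h2
    exact lt_irrefl _ ((hk1.trans_le h2).trans hk2)
  rw [← hψ.coe_toReal hxψ] at hle ⊢
  rw [← hψ.coe_toReal hy]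
  have h3 : (ψ x).toReal ≤ (ψ y).toReal - ⟪p - grad f x, y - x⟫_ℝ := by exact_mod_cast hle
  have h4 : (ψ x).toReal + ⟪p - grad f x, y - x⟫_ℝ ≤ (ψ y).toReal := by linarith
  exact_mod_cast h4

theorem lowerSemicontinuous_coe_add (hψ : ProperConvexLsc ψ) {q : E → ℝ} (hq : Continuous q) :
    LowerSemicontinuous fun y => (q y : EReal) + ψ y :=
  LowerSemicontinuous.add' (continuous_coe_real_ereal.comp hq).lowerSemicontinuous hψ.lsc
    fun _ => EReal.continuousAt_add (Or.inl (EReal.coe_ne_top _)) (Or.inl (EReal.coe_ne_bot _))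

end Subgradients

/-! ### Identification of the manifold -/

section Identification

variable {E : Type*} [NormedAddCommGroup E] [InnerProductSpace ℝ E]

/-- In a straightening chart, tangent vectors are images of vectors of the model subspace. -/
theorem exists_eq_fderiv_symm_of_mem_tangentVectors [FiniteDimensional ℝ E] {S : Set E} {x : E}
    {e : OpenPartialHomeomorph E E} {V : Submodule ℝ E} (hxe : x ∈ e.source)
    (he : ContDiffOn ℝ 2 e e.source) (he' : ContDiffOn ℝ 2 e.symm e.target)
    (hS : e '' (e.source ∩ S) = e.target ∩ (V : Set E)) {w : E}
    (hw : w ∈ tangentVectors S x) : ∃ v ∈ V, w = fderiv ℝ e.symm (e x) v := by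
  obtain ⟨γ, h0, hγS, -, hγ⟩ := hw
  have hd : HasFDerivAt e (fderiv ℝ e (γ 0)) (γ 0) := by
    rw [h0]
    exact ((he.differentiableOn two_ne_zero x hxe).differentiableAt
      (e.open_source.mem_nhds hxe)).hasFDerivAt
  have hd' : HasFDerivAt e.symm (fderiv ℝ e.symm ((e ∘ γ) 0)) ((e ∘ γ) 0) := by
    have : e (γ 0) ∈ e.target := by rw [h0]; exact e.map_source hxe
    exact ((he'.differentiableOn two_ne_zero _ this).differentiableAt
      (e.open_target.mem_nhds this)).hasFDerivAt
  have h1 := hd.comp_hasDerivAt (0 : ℝ) hγ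
  have h2 := hd'.comp_hasDerivAt (0 : ℝ) h1
  have hsrc : ∀ᶠ t in 𝓝 (0 : ℝ), γ t ∈ e.source :=
    hγ.continuousAt (by rw [h0]; exact e.open_source.mem_nhds hxe)
  have hV : ∀ᶠ t in 𝓝 (0 : ℝ), e (γ t) ∈ V := by
    filter_upwards [hsrc, hγS] with t ht1 ht2
    have : e (γ t) ∈ e.target ∩ (V : Set E) := hS ▸ Set.mem_image_of_mem e ⟨ht1, ht2⟩
    exact this.2
  refine ⟨fderiv ℝ e (γ 0) w, ?_, ?_⟩
  · have hsl := hasDerivAt_iff_tendsto_slope.1 h1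
    refine (Submodule.closed_of_finiteDimensional V).mem_of_tendsto hsl ?_
    filter_upwards [nhdsWithin_le_nhds hV] with t ht
    rw [slope_def_module]
    exact V.smul_mem _ (V.sub_mem ht hV.self_of_nhds)
  · have hcongr : e.symm ∘ (e ∘ γ) =ᶠ[𝓝 0] γ := by
      filter_upwards [hsrc] with t ht
      exact e.left_inv ht
    have := (h2.congr_of_eventuallyEq hcongr.symm).unique hγ
    refine this.symm.trans ?_
    rw [Function.comp_apply, h0]

/-- A `C²`-submanifold admits a local nearest-point map whose normalised residual becomes
orthogonal to every tangent vector at the base point. -/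
theorem IsC2SubmanifoldAt.exists_nearest_point [FiniteDimensional ℝ E] {S : Set E} {x : E}
    (hS : IsC2SubmanifoldAt S x) :
    ∃ P : E → E, Tendsto P (𝓝 x) (𝓝[S] x) ∧ ∀ w ∈ tangentVectors S x,
      Tendsto (fun u => ⟪‖u - P u‖⁻¹ • (u - P u), w⟫_ℝ) (𝓝 x) (𝓝 0) := by
  obtain ⟨hxS, e, V, hxe, he, he', hSV⟩ := hS
  have hy0 : e x ∈ e.target ∩ (V : Set E) := hSV ▸ Set.mem_image_of_mem e ⟨hxe, hxS⟩
  obtain ⟨r, hr, hrt⟩ := Metric.nhds_basis_closedBall.mem_iff.1 (e.open_target.mem_nhds hy0.1)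
  set K : Set E := e.symm '' (Metric.closedBall (e x) r ∩ V) with hK
  have hKc : IsCompact K :=
    ((isCompact_closedBall _ _).inter_right
      (Submodule.closed_of_finiteDimensional V)).image_of_continuousOn
      (he'.continuousOn.mono (Set.inter_subset_left.trans hrt))
  have hxK : x ∈ K := ⟨e x, ⟨Metric.mem_closedBall_self hr.le, hy0.2⟩, e.left_inv hxe⟩
  have hKS : K ⊆ S := by
    rintro _ ⟨y, hy, rfl⟩
    have : y ∈ e '' (e.source ∩ S) := hSV ▸ ⟨hrt hy.1, hy.2⟩
    obtain ⟨s, hs, rfl⟩ := this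
    rw [e.left_inv hs.1]
    exact hs.2
  have hKe : ∀ p ∈ K, p ∈ e.source ∧ e p ∈ V := by
    rintro _ ⟨y, hy, rfl⟩
    exact ⟨e.map_target (hrt hy.1), by rw [e.right_inv (hrt hy.1)]; exact hy.2⟩
  choose P hPK hP using fun u : E => hKc.exists_infDist_eq_dist ⟨x, hxK⟩ u
  have hmin : ∀ u, ∀ p ∈ K, dist u (P u) ≤ dist u p := fun u p hp =>
    hP u ▸ Metric.infDist_le_dist_of_mem hp
  have hPx : Tendsto P (𝓝 x) (𝓝 x) := by
    rw [tendsto_iff_dist_tendsto_zero]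
    have h2 : Tendsto (fun u => 2 * dist u x) (𝓝 x) (𝓝 (2 * dist x x)) :=
      Continuous.tendsto (by fun_prop) x
    rw [dist_self, mul_zero] at h2
    refine squeeze_zero (fun _ => dist_nonneg) (fun u => ?_) h2
    have := dist_triangle_left (P u) x u
    linarith [hmin u x hxK]
  refine ⟨P, tendsto_nhdsWithin_iff.2 ⟨hPx, .of_forall fun u => hKS (hPK u)⟩, fun w hw => ?_⟩
  obtain ⟨v, hv, rfl⟩ := exists_eq_fderiv_symm_of_mem_tangentVectors hxe he he' hSV hw
  have hePx : Tendsto (fun u => e (P u)) (𝓝 x) (𝓝 (e x)) :=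
    (e.continuousAt hxe).tendsto.comp hPx
  -- first-order optimality of the nearest point along the curve with chart velocity `v`
  have horth : ∀ᶠ u in 𝓝 x, ⟪u - P u, fderiv ℝ e.symm (e (P u)) v⟫_ℝ = 0 := by
    filter_upwards [hePx.eventually (Metric.ball_mem_nhds _ hr)] with u hu
    have hline : HasDerivAt (fun t : ℝ => e (P u) + t • v) v 0 := by
      simpa using ((hasDerivAt_id (0 : ℝ)).smul_const v).const_add (e (P u))
    have htgt : e (P u) ∈ e.target := e.map_source (hKe _ (hPK u)).1
    have hd : HasFDerivAt e.symm (fderiv ℝ e.symm (e (P u))) (e (P u) + (0 : ℝ) • v) := by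
      rw [zero_smul, add_zero]
      exact ((he'.differentiableOn two_ne_zero _ htgt).differentiableAt
        (e.open_target.mem_nhds htgt)).hasFDerivAt
    have hc := ((hd.comp_hasDerivAt (0 : ℝ) hline).const_sub u).norm_sq
    have hlm : IsLocalMin
        (fun t : ℝ => ‖u - (e.symm ∘ fun t : ℝ => e (P u) + t • v) t‖ ^ 2) 0 := by
      have hev : ∀ᶠ t in 𝓝 (0 : ℝ), e (P u) + t • v ∈ Metric.ball (e x) r :=
        hline.continuousAt (by rw [zero_smul, add_zero]; exact Metric.isOpen_ball.mem_nhds hu)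
      filter_upwards [hev] with t ht
      have h1 := hmin u (e.symm (e (P u) + t • v))
        ⟨_, ⟨Metric.ball_subset_closedBall ht, V.add_mem (hKe _ (hPK u)).2 (V.smul_mem t hv)⟩, rfl⟩
      rw [dist_eq_norm, dist_eq_norm] at h1
      have h2 : e.symm (e (P u)) = P u := e.left_inv (hKe _ (hPK u)).1
      simp only [Function.comp_apply, zero_smul, add_zero, h2]
      gcongr
    have h0 := hlm.hasDerivAt_eq_zero hc
    have h2 : e.symm (e (P u)) = P u := e.left_inv (hKe _ (hPK u)).1
    simpa [h2] using h0
  have hcont : ContinuousAt (fderiv ℝ e.symm) (e x) :=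
    (he'.continuousOn_fderiv_of_isOpen e.open_target one_le_two).continuousAt
      (e.open_target.mem_nhds hy0.1)
  have hlim : Tendsto (fun u => ‖fderiv ℝ e.symm (e x) v - fderiv ℝ e.symm (e (P u)) v‖)
      (𝓝 x) (𝓝 0) := by
    have h1 : Tendsto (fun u => fderiv ℝ e.symm (e (P u)) v) (𝓝 x)
        (𝓝 (fderiv ℝ e.symm (e x) v)) :=
      ((ContinuousLinearMap.apply ℝ E v).continuous.tendsto _).comp (hcont.tendsto.comp hePx)
    simpa using (h1.const_sub (fderiv ℝ e.symm (e x) v)).norm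
  refine squeeze_zero_norm' ?_ hlim
  filter_upwards [horth] with u hu
  have h1 : ⟪‖u - P u‖⁻¹ • (u - P u), fderiv ℝ e.symm (e x) v⟫_ℝ =
      ⟪‖u - P u‖⁻¹ • (u - P u),
        fderiv ℝ e.symm (e x) v - fderiv ℝ e.symm (e (P u)) v⟫_ℝ := by
    rw [inner_sub_right, real_inner_smul_left _ (fderiv ℝ e.symm (e (P u)) v), hu, mul_zero,
      sub_zero]
  rw [h1]
  refine (norm_inner_le_norm _ _).trans (mul_le_of_le_one_left (norm_nonneg _) ?_)
  rw [norm_smul, norm_inv, norm_norm]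
  exact inv_mul_le_one

theorem exists_smul_mem_of_zero_mem_intrinsicInterior {T : Set E}
    (hT : (0 : E) ∈ intrinsicInterior ℝ T) {n : E} (hn : n ∈ (affineSpan ℝ T).direction) :
    ∃ ε : ℝ, 0 < ε ∧ ε • n ∈ T := by
  obtain ⟨z, hz, hz0⟩ := mem_intrinsicInterior.1 hT
  have h0 : (0 : E) ∈ affineSpan ℝ T := hz0 ▸ z.2
  have hmem : ∀ t : ℝ, t • n ∈ affineSpan ℝ T := fun t => by
    simpa using AffineSubspace.vadd_mem_of_mem_direction
      ((affineSpan ℝ T).direction.smul_mem t hn) h0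
  have hc : Continuous fun t : ℝ => (⟨t • n, hmem t⟩ : affineSpan ℝ T) :=
    Continuous.subtype_mk (by fun_prop) _
  have hz' : (⟨(0 : ℝ) • n, hmem 0⟩ : affineSpan ℝ T) = z := Subtype.ext (by simp [hz0])
  have hev : ∀ᶠ t in 𝓝 (0 : ℝ), t • n ∈ T := by
    have := hc.continuousAt.preimage_mem_nhds (hz'.symm ▸ mem_interior_iff_mem_nhds.1 hz)
    exact this
  obtain ⟨ε, h1, h2⟩ :=
    ((hev.filter_mono (nhdsWithin_le_nhds (s := Set.Ioi 0))).and
      eventually_mem_nhdsWithin).exists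
  exact ⟨ε, h2, h1⟩

/-- Identification for sequences off the manifold: the residual direction of the nearest point has
a limit `n` in the normal space, a positive multiple of `n` is a subgradient at `x` and therefore
close to subgradients at the nearest points, and this contradicts the monotonicity of `∂ψ`. -/
theorem not_tendsto_subgradient_of_notMem [FiniteDimensional ℝ E] [CompleteSpace E]
    {f ψ : E → EReal} (hf : SmoothOnDom f) (hψ : ProperConvexLsc ψ) {M : Set E} {x : E}
    (hM : PartlySmoothAt (objective f ψ) M x)
    (h0 : (0 : E) ∈ intrinsicInterior ℝ (limitingSubdiff (objective f ψ) x))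
    {u g : ℕ → E} (huM : ∀ k, u k ∉ M) (hu : Tendsto u atTop (𝓝 x))
    (hg : ∀ k, g k ∈ convexSubdiff ψ (u k)) :
    ¬ Tendsto (fun k => grad f (u k) + g k) atTop (𝓝 0) := by
  intro hg0
  have hxF : x ∈ effDom (objective f ψ) := (intrinsicInterior_subset h0).1
  have hxf := ((mem_effDom_objective hf hψ).1 hxF).1
  obtain ⟨P, hP, hPn⟩ := hM.manifold.exists_nearest_point
  have hPM : ∀ᶠ k in atTop, P (u k) ∈ M :=
    (tendsto_nhdsWithin_iff.1 (hP.comp hu)).2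
  obtain ⟨k₀, hk₀⟩ := eventually_atTop.1 hPM
  have hne : ∀ k, k₀ ≤ k → u k - P (u k) ≠ 0 := fun k hk h =>
    huM k (sub_eq_zero.1 h ▸ hk₀ k hk)
  obtain ⟨n, hn, φ, hφ, hφn⟩ := (isCompact_sphere (0 : E) 1).tendsto_subseq
    (x := fun k => ‖u (k + k₀) - P (u (k + k₀))‖⁻¹ • (u (k + k₀) - P (u (k + k₀)))) (fun k => by
      rw [mem_sphere_zero_iff_norm, norm_smul, norm_inv, norm_norm]
      exact inv_mul_cancel₀ (norm_ne_zero_iff.2 (hne _ (Nat.le_add_left _ _))))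
  have hnorm : ‖n‖ = 1 := mem_sphere_zero_iff_norm.1 hn
  set s : ℕ → ℕ := fun k => φ k + k₀ with hs
  have hst : Tendsto s atTop atTop := (tendsto_add_atTop_nat k₀).comp hφ.tendsto_atTop
  have hus : Tendsto (fun k => u (s k)) atTop (𝓝 x) := hu.comp hst
  have hnn : n ∈ normalSpace M x := fun w hw =>
    tendsto_nhds_unique (Tendsto.inner hφn tendsto_const_nhds) ((hPn w hw).comp hus)
  rw [hM.normal_sharp] at hnn
  obtain ⟨ε, hε, hεn⟩ := exists_smul_mem_of_zero_mem_intrinsicInterior h0 hnn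
  have hinner := (hP.comp hus).eventually (hM.subgradient_continuous.2 _ hεn (ε / 2) (half_pos hε))
  have hPx : Tendsto (fun k => P (u (s k))) atTop (𝓝 x) :=
    (tendsto_nhdsWithin_iff.1 (hP.comp hus)).1
  have hgr := (hf.continuousAt_grad hxf).tendsto
  have hlim1 : Tendsto (fun k => ‖(grad f (u (s k)) + g (s k)) -
      (grad f (u (s k)) - grad f (P (u (s k))))‖) atTop (𝓝 0) := by
    simpa using ((hg0.comp hst).sub ((hgr.comp hus).sub (hgr.comp hPx))).norm
  have hlim2 : Tendsto (fun k => ⟪ε • n, ‖u (s k) - P (u (s k))‖⁻¹ • (u (s k) - P (u (s k)))⟫_ℝ)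
      atTop (𝓝 ε) := by
    have := Tendsto.inner (𝕜 := ℝ) (tendsto_const_nhds (x := ε • n)) hφn
    rwa [real_inner_smul_left, real_inner_self_eq_norm_sq, hnorm, one_pow, mul_one] at this
  obtain ⟨k, ⟨⟨q, hq, hqn⟩, h1⟩, h2⟩ := ((hinner.and
    (hlim1.eventually (gt_mem_nhds (show (0 : ℝ) < ε / 4 by positivity)))).and
      (hlim2.eventually (lt_mem_nhds (show 3 * ε / 4 < ε by linarith)))).exists
  simp only [Function.comp_apply] at hq
  have hmono := convexSubdiff_monotone hψ (hg (s k)) (sub_grad_mem_convexSubdiff hf hψ hq)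
  set d := u (s k) - P (u (s k)) with hd
  have hd0 : d ≠ 0 := hne _ (Nat.le_add_left _ _)
  have hnd : ‖‖d‖⁻¹ • d‖ = 1 := by
    rw [norm_smul, norm_inv, norm_norm]
    exact inv_mul_cancel₀ (norm_ne_zero_iff.2 hd0)
  have h3 : 0 ≤ ⟪g (s k) - (q - grad f (P (u (s k)))), ‖d‖⁻¹ • d⟫_ℝ := by
    rw [real_inner_smul_right]
    positivity
  have e1 : g (s k) - (q - grad f (P (u (s k)))) =
      ((grad f (u (s k)) + g (s k)) - (grad f (u (s k)) - grad f (P (u (s k))))) -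
        (q - ε • n) - ε • n := by abel
  rw [e1, inner_sub_left, inner_sub_left] at h3
  have h4 := real_inner_le_norm ((grad f (u (s k)) + g (s k)) -
    (grad f (u (s k)) - grad f (P (u (s k))))) (‖d‖⁻¹ • d)
  have h5 := neg_le_of_abs_le (abs_real_inner_le_norm (q - ε • n) (‖d‖⁻¹ • d))
  rw [hnd, mul_one] at h4 h5
  linarith

/-- Finite identification for `F = f + ψ`: near a nondegenerate partly smooth critical point, points
off the manifold have no small subgradients `∇f(u) + g`, `g ∈ ∂ψ(u)`. -/
theorem exists_identification_radius [FiniteDimensional ℝ E] [CompleteSpace E] {f ψ : E → EReal}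
    (hf : SmoothOnDom f) (hψ : ProperConvexLsc ψ) {M : Set E} {x : E}
    (hM : PartlySmoothAt (objective f ψ) M x)
    (h0 : (0 : E) ∈ intrinsicInterior ℝ (limitingSubdiff (objective f ψ) x)) :
    ∃ δ : ℝ, 0 < δ ∧ ∀ u g : E, ‖u - x‖ < δ → g ∈ convexSubdiff ψ u → ‖grad f u + g‖ < δ →
      u ∈ M := by
  by_contra! hcon
  choose u g hu hg hug huM using fun k : ℕ => hcon (1 / ((k : ℝ) + 1)) (by positivity)
  have hz := tendsto_one_div_add_atTop_nhds_zero_nat (𝕜 := ℝ)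
  refine not_tendsto_subgradient_of_notMem hf hψ hM h0 huM ?_ hg ?_
  · exact tendsto_iff_norm_sub_tendsto_zero.2
      (squeeze_zero (fun _ => norm_nonneg _) (fun k => (hu k).le) hz)
  · exact squeeze_zero_norm (fun k => (hug k).le) hz

end Identification

/-! ### Acceptance of trial points -/

section Acceptance

variable {E : Type*} [NormedAddCommGroup E] [InnerProductSpace ℝ E] [CompleteSpace E]
  {f ψ : E → EReal} {H : E → E →L[ℝ] E} {L : ℝ}

/-- The main inequality forces `H` to be locally bounded, because `∇f` is. -/
theorem MainInequality.exists_norm_le (hf : SmoothOnDom f) (hmain : MainInequality f H L)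
    {x₀ : E} (hx₀ : x₀ ∈ effDom f) : ∃ C : ℝ, 0 ≤ C ∧ ∀ᶠ x in 𝓝 x₀, ‖H x‖ ≤ C := by
  have hev : ∀ᶠ x in 𝓝 x₀, x ∈ effDom f ∧ ‖grad f x - grad f x₀‖ < 1 := by
    refine Filter.Eventually.and (hf.isOpen.mem_nhds hx₀) ?_
    have := ((hf.continuousAt_grad hx₀).tendsto.sub_const (grad f x₀)).norm
    rw [sub_self, norm_zero] at this
    exact this.eventually (gt_mem_nhds one_pos)
  obtain ⟨r, hr, hball⟩ := Metric.eventually_nhds_iff_ball.1 hev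
  have hL := hmain.1
  have hC : 0 ≤ (2 + L * (r / 2)) / (r / 2) := by positivity
  refine ⟨_, hC, ?_⟩
  filter_upwards [Metric.ball_mem_nhds x₀ (half_pos hr)] with x hx
  refine ContinuousLinearMap.opNorm_le_bound _ hC fun w => ?_
  rcases eq_or_ne w 0 with rfl | hw
  · simp
  have hw0 : 0 < ‖w‖ := norm_pos_iff.2 hw
  have hxr : dist x x₀ < r / 2 := hx
  obtain ⟨hxf, hx1⟩ := hball x (Metric.ball_subset_ball (by linarith) hx)
  set s : ℝ := r / 2 / ‖w‖ with hs
  have hs0 : 0 < s := by positivity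
  have hsw : ‖s • w‖ = r / 2 := by
    rw [norm_smul, Real.norm_of_nonneg hs0.le, hs, div_mul_cancel₀ _ hw0.ne']
  have hyb : x + s • w ∈ Metric.ball x₀ r := by
    rw [Metric.mem_ball, dist_eq_norm] at *
    calc ‖x + s • w - x₀‖ = ‖(x - x₀) + s • w‖ := by congr 1; abel
      _ ≤ ‖x - x₀‖ + ‖s • w‖ := norm_add_le _ _
      _ < r := by linarith
  obtain ⟨hyf, hy1⟩ := hball _ hyb
  have h1 := hmain.2.2 x hxf _ hyf
  rw [add_sub_cancel_left, sub_add_cancel_left, norm_neg, hsw] at h1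
  have h2 : ‖H x (s • w)‖ ≤ 2 + L * (r / 2) := by
    have e : H x (s • w) = (grad f (x + s • w) - grad f x₀) - (grad f x - grad f x₀) -
        (grad f (x + s • w) - grad f x - H x (s • w)) := by abel
    rw [e]
    refine (norm_sub_le _ _).trans ?_
    linarith [norm_sub_le (grad f (x + s • w) - grad f x₀) (grad f x - grad f x₀)]
  rw [map_smul, norm_smul, Real.norm_of_nonneg hs0.le] at h2
  have h3 : ‖H x w‖ ≤ (2 + L * (r / 2)) / s := by
    rw [le_div_iff₀ hs0, mul_comm]
    exact h2
  refine h3.trans_eq ?_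
  rw [hs]
  field_simp

/-- The descent inequality for the quadratic model on a convex part of the domain. -/
theorem MainInequality.descent (hf : SmoothOnDom f) (hmain : MainInequality f H L) {U : Set E}
    (hU : Convex ℝ U) (hUf : U ⊆ effDom f) {x z : E} (hx : x ∈ U) (hz : z ∈ U) :
    (f z).toReal ≤ (f x).toReal + ⟪grad f x, z - x⟫_ℝ + 1 / 2 * ⟪H x (z - x), z - x⟫_ℝ +
      L / 2 * ‖z - x‖ ^ 2 := by
  set d := z - x with hd
  have hmem : ∀ t ∈ Set.Icc (0 : ℝ) 1, x + t • d ∈ U := fun t ht =>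
    hU.add_smul_sub_mem hx hz ht
  have hder : ∀ t ∈ Set.Icc (0 : ℝ) 1,
      HasDerivAt (fun t : ℝ => (f (x + t • d)).toReal - t * ⟪grad f x, d⟫_ℝ -
        t ^ 2 / 2 * (⟪H x d, d⟫_ℝ + L * ‖d‖ ^ 2))
      (⟪grad f (x + t • d), d⟫_ℝ - ⟪grad f x, d⟫_ℝ - t * (⟪H x d, d⟫_ℝ + L * ‖d‖ ^ 2)) t := by
    intro t ht
    have h1 : HasDerivAt (fun t : ℝ => x + t • d) d t := by
      simpa using ((hasDerivAt_id t).smul_const d).const_add x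
    have h2 := (hf.hasGradientAt (hUf (hmem t ht))).hasFDerivAt.comp_hasDerivAt t h1
    have h3 : HasDerivAt (fun t : ℝ => t * ⟪grad f x, d⟫_ℝ) ⟪grad f x, d⟫_ℝ t := by
      simpa using (hasDerivAt_id t).mul_const ⟪grad f x, d⟫_ℝ
    have h4 : HasDerivAt (fun t : ℝ => t ^ 2 / 2 * (⟪H x d, d⟫_ℝ + L * ‖d‖ ^ 2))
        (t * (⟪H x d, d⟫_ℝ + L * ‖d‖ ^ 2)) t := by
      have := ((hasDerivAt_pow 2 t).div_const 2).mul_const (⟪H x d, d⟫_ℝ + L * ‖d‖ ^ 2)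
      refine this.congr_deriv ?_
      norm_num
    exact ((h2.sub h3).sub h4).congr_deriv (by simp)
  have hanti := antitoneOn_of_deriv_nonpos (convex_Icc (0 : ℝ) 1)
    (fun t ht => (hder t ht).continuousAt.continuousWithinAt)
    (fun t ht => (hder t (interior_subset ht)).differentiableAt.differentiableWithinAt)
    (fun t ht => by
      have ht' := interior_subset ht
      rw [(hder t ht').deriv]
      have h1 := hmain.2.2 x (hUf hx) _ (hUf (hmem t ht'))
      rw [add_sub_cancel_left, sub_add_cancel_left, norm_neg, map_smul, norm_smul,
        Real.norm_of_nonneg ht'.1] at h1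
      have h2 := (real_inner_le_norm (grad f (x + t • d) - grad f x - t • H x d) d).trans
        (mul_le_mul_of_nonneg_right h1 (norm_nonneg d))
      rw [inner_sub_left, inner_sub_left, real_inner_smul_left] at h2
      nlinarith)
  have h := hanti (Set.left_mem_Icc.2 zero_le_one) (Set.right_mem_Icc.2 zero_le_one) zero_le_one
  simp only [one_smul, zero_smul, add_zero, hd, add_sub_cancel] at h
  linarith

theorem norm_trialSubgrad_le (hmain : MainInequality f H L) {lam : ℝ} (hlam : 0 ≤ lam) {x z : E}
    (hx : x ∈ effDom f) (hz : z ∈ effDom f) :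
    ‖trialSubgrad f H lam x z‖ ≤ (L + lam) * ‖z - x‖ := by
  have h := hmain.2.2 x hx z hz
  have e : trialSubgrad f H lam x z = (grad f z - grad f x - H x (z - x)) - lam • (z - x) := by
    rw [trialSubgrad]; abel
  rw [e]
  refine (norm_sub_le _ _).trans ?_
  rw [norm_smul, Real.norm_of_nonneg hlam]
  rw [norm_sub_rev x z] at h
  linarith

/-- If the regularisation dominates `H`, trial points computed near a critical point `x₀` stay near
it, by monotonicity of `∂ψ` at the trial point and at `x₀`. -/
theorem IsTrialPoint.norm_sub_le (hψ : ProperConvexLsc ψ) {x₀ x z : E}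
    (h₀ : -grad f x₀ ∈ convexSubdiff ψ x₀) {lam C ρ : ℝ} (hz : IsTrialPoint f ψ H lam x z)
    (hC : 0 ≤ C) (hHC : ‖H x‖ ≤ C) (hlam : 4 * C + 4 ≤ lam) (hx : ‖x - x₀‖ ≤ ρ / 4)
    (hg : ‖grad f x - grad f x₀‖ ≤ ρ) : ‖z - x‖ ≤ ρ := by
  by_contra! hcon
  have hmono := convexSubdiff_monotone hψ hz.first_order h₀
  set d := z - x with hd
  set u := x - x₀ with hu
  have e1 : z - x₀ = d + u := by rw [hd, hu]; abel
  have e2 : -grad f x - H x d - lam • d - -grad f x₀ =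
      -(grad f x - grad f x₀) - H x d - lam • d := by abel
  have h1 := neg_le_of_abs_le (abs_real_inner_le_norm (grad f x - grad f x₀) (d + u))
  have h2 := neg_le_of_abs_le (abs_real_inner_le_norm (H x d) (d + u))
  have h3 := neg_le_of_abs_le (abs_real_inner_le_norm d u)
  have h4 : ‖H x d‖ ≤ C * ‖d‖ := (H x).le_of_opNorm_le hHC d
  have h5 := norm_add_le d u
  have hu0 := norm_nonneg u
  have hd0 : 0 < ‖d‖ := lt_of_le_of_lt (by linarith) hcon
  rw [e1, e2, inner_sub_left, inner_sub_left, inner_neg_left, real_inner_smul_left,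
    inner_add_right d, real_inner_self_eq_norm_sq] at hmono
  have h6 : ‖grad f x - grad f x₀‖ * ‖d + u‖ ≤ ‖d‖ * (5 / 4 * ‖d‖) := by
    gcongr <;> linarith
  have h7 : ‖H x d‖ * ‖d + u‖ ≤ C * ‖d‖ * (5 / 4 * ‖d‖) := by
    gcongr; linarith
  have h8 : ‖d‖ * ‖u‖ ≤ ‖d‖ * (‖d‖ / 4) := by
    gcongr; linarith
  have hlam0 : 0 ≤ lam := by linarith
  have h9 : lam * (-⟪d, u⟫_ℝ) ≤ lam * (‖d‖ * (‖d‖ / 4)) :=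
    mul_le_mul_of_nonneg_left (by linarith) hlam0
  have h10 : (4 * C + 4) * ‖d‖ ^ 2 ≤ lam * ‖d‖ ^ 2 := by gcongr
  have hd2 : 0 < ‖d‖ ^ 2 := by positivity
  have h11 : 0 ≤ C * ‖d‖ ^ 2 := by positivity
  nlinarith

/-- The acceptance conditions hold once `lam ≥ m L` and a convex part of `dom f` contains both the
current point and the trial point. -/
theorem IsTrialPoint.accepted (hf : SmoothOnDom f) (hψ : ProperConvexLsc ψ)
    (hmain : MainInequality f H L) {α β m : ℝ} (hα : α ≤ 1 / 2) (hm : 1 ≤ m)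
    (hβ : β ≤ (m - 1) / (2 * m)) {U : Set E} (hU : Convex ℝ U) (hUf : U ⊆ effDom f) {x z : E}
    {lam : ℝ} (hz : IsTrialPoint f ψ H lam x z) (hlam0 : 0 < lam) (hlam : m * L ≤ lam)
    (hxU : x ∈ U) (hzU : z ∈ U) (hxψ : x ∈ effDom ψ) : Accepted f ψ H α β lam x z := by
  have hL := hmain.1
  have hLlam : L ≤ lam := by nlinarith
  have hzψ : z ∈ effDom ψ := hz.first_order.1
  have hxf := hUf hxU
  have hzf := hUf hzU
  constructor
  · have h := hmain.2.2 x hxf z hzf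
    rw [norm_sub_rev x z] at h
    set d := z - x with hd
    set v := grad f z - grad f x - H x d with hv
    have e : trialSubgrad f H lam x z = v - lam • d := by
      rw [trialSubgrad, hv, hd]; abel
    have e2 : x - z = -d := by rw [hd]; abel
    have h1 : ‖v‖ ^ 2 ≤ (lam * ‖d‖) ^ 2 := by
      gcongr
      exact h.trans (by gcongr)
    rw [e, e2, inner_neg_right, inner_sub_left, real_inner_smul_left, real_inner_self_eq_norm_sq]
    have h2 : α / lam * ‖v - lam • d‖ ^ 2 ≤ 1 / 2 / lam * ‖v - lam • d‖ ^ 2 := by gcongr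
    refine h2.trans ?_
    rw [norm_sub_sq_real, real_inner_smul_right, norm_smul, Real.norm_of_nonneg hlam0.le,
      div_mul_eq_mul_div, div_le_iff₀ hlam0]
    nlinarith
  · have h := hz.model_le
    have hdesc := hmain.descent hf hU hUf hxU hzU
    rw [model, model, ← hf.coe_toReal hxf, ← hψ.coe_toReal hxψ, ← hψ.coe_toReal hzψ] at h
    have h1 : (f x).toReal + (⟪grad f x, z - x⟫_ℝ + 1 / 2 * ⟪H x (z - x), z - x⟫_ℝ +
        lam / 2 * ‖z - x‖ ^ 2) + (ψ z).toReal ≤ (f x).toReal + (ψ x).toReal := by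
      have h2 : ((f x).toReal : EReal) + ((⟪grad f x, z - x⟫_ℝ + 1 / 2 * ⟪H x (z - x), z - x⟫_ℝ +
        lam / 2 * ‖z - x‖ ^ 2 : ℝ) : EReal) + (ψ z).toReal ≤ (f x).toReal + (ψ x).toReal := by
        simpa using h
      exact_mod_cast h2
    rw [objective_eq_coe hf hψ hxf hxψ, objective_eq_coe hf hψ hzf hzψ]
    have hm0 : 0 < 2 * m := by linarith
    rw [le_div_iff₀ hm0] at hβ
    have h3 : β * lam ≤ lam / 2 - L / 2 := by
      have : (2 * m) * (β * lam) ≤ (2 * m) * (lam / 2 - L / 2) := by nlinarith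
      exact le_of_mul_le_mul_left this hm0
    have h4 := mul_le_mul_of_nonneg_right h3 (sq_nonneg ‖z - x‖)
    have h5 : (f z).toReal + (ψ z).toReal + β * lam * ‖z - x‖ ^ 2 ≤
        (f x).toReal + (ψ x).toReal := by linarith
    exact_mod_cast h5

/-- Near a critical point, all trial points with a large regularisation parameter are accepted. -/
theorem eventually_forall_accepted (hf : SmoothOnDom f) (hψ : ProperConvexLsc ψ)
    (hmain : MainInequality f H L) {α β m : ℝ} (hα : α ≤ 1 / 2) (hm : 1 ≤ m)
    (hβ : β ≤ (m - 1) / (2 * m)) {x₀ : E} (hx₀ : x₀ ∈ effDom f)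
    (h₀ : -grad f x₀ ∈ convexSubdiff ψ x₀) :
    ∃ B : ℝ, ∀ᶠ x in 𝓝 x₀, x ∈ effDom ψ → ∀ lam, B ≤ lam → ∀ z,
      IsTrialPoint f ψ H lam x z → Accepted f ψ H α β lam x z := by
  obtain ⟨C, hC, hHC⟩ := hmain.exists_norm_le hf hx₀
  obtain ⟨r, hr, hball⟩ := Metric.isOpen_iff.1 hf.isOpen x₀ hx₀
  have hgrad : ∀ᶠ x in 𝓝 x₀, ‖grad f x - grad f x₀‖ < r / 2 := by
    have := ((hf.continuousAt_grad hx₀).tendsto.sub_const (grad f x₀)).norm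
    rw [sub_self, norm_zero] at this
    exact this.eventually (gt_mem_nhds (half_pos hr))
  refine ⟨max (4 * C + 4) (m * L), ?_⟩
  filter_upwards [hHC, hgrad, Metric.ball_mem_nhds x₀ (show 0 < r / 8 by positivity)]
    with x h1 h2 h3 hxψ lam hlam z hz
  have h3' : ‖x - x₀‖ < r / 8 := by rwa [← dist_eq_norm]
  have hd := hz.norm_sub_le hψ h₀ hC h1 ((le_max_left _ _).trans hlam) (ρ := r / 2)
    (by linarith) h2.le
  refine hz.accepted hf hψ hmain hα hm hβ (convex_ball x₀ r) hball ?_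
    ((le_max_right _ _).trans hlam) ?_ ?_ hxψ
  · linarith [le_max_left (4 * C + 4) (m * L)]
  · exact Metric.ball_subset_ball (by linarith) h3
  · rw [Metric.mem_ball, dist_eq_norm]
    calc ‖z - x₀‖ = ‖(z - x) + (x - x₀)‖ := by congr 1; abel
      _ ≤ ‖z - x‖ + ‖x - x₀‖ := norm_add_le _ _
      _ < r := by linarith

end Acceptance

/-! ### Trial points of convex models -/

section ConvexModel

variable {E : Type*} [NormedAddCommGroup E] [InnerProductSpace ℝ E] [CompleteSpace E]
  {f ψ : E → EReal} {H : E → E →L[ℝ] E}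

/-- For positive semidefinite `H x` the model is strongly monotone, so the step length is controlled
by any subgradient `∇f(x) + g` of the objective at `x`. -/
theorem IsTrialPoint.mul_norm_sub_le (hψ : ProperConvexLsc ψ) {x z g : E} {lam : ℝ}
    (hH : ∀ d : E, 0 ≤ ⟪H x d, d⟫_ℝ) (hg : g ∈ convexSubdiff ψ x)
    (hz : IsTrialPoint f ψ H lam x z) : lam * ‖z - x‖ ≤ ‖grad f x + g‖ := by
  have hmono := convexSubdiff_monotone hψ hz.first_order hg
  have hHd := hH (z - x)
  set d := z - x with hd
  have e : -grad f x - H x d - lam • d - g = -(grad f x + g) - H x d - lam • d := by abel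
  rw [e, inner_sub_left, inner_sub_left, inner_neg_left, real_inner_smul_left,
    real_inner_self_eq_norm_sq] at hmono
  have h1 := neg_le_of_abs_le (abs_real_inner_le_norm (grad f x + g) d)
  rcases eq_or_lt_of_le (norm_nonneg d) with h0 | h0
  · rw [← h0, mul_zero]
    exact norm_nonneg _
  · refine le_of_mul_le_mul_right ?_ h0
    nlinarith

/-- If `H x` is positive semidefinite and `lam > 0`, the model is strongly convex, and its minimiser
is a trial point. -/
theorem exists_isTrialPoint [FiniteDimensional ℝ E] (hf : SmoothOnDom f) (hψ : ProperConvexLsc ψ)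
    {x g : E} {lam : ℝ} (hlam : 0 < lam) (hxf : x ∈ effDom f)
    (hsymm : ∀ u v, ⟪H x u, v⟫_ℝ = ⟪u, H x v⟫_ℝ) (hH : ∀ d : E, 0 ≤ ⟪H x d, d⟫_ℝ)
    (hg : g ∈ convexSubdiff ψ x) : ∃ z, IsTrialPoint f ψ H lam x z := by
  set q : E → ℝ := fun y =>
    ⟪grad f x, y - x⟫_ℝ + 1 / 2 * ⟪H x (y - x), y - x⟫_ℝ + lam / 2 * ‖y - x‖ ^ 2 with hq
  have hqx : q x = 0 := by simp [hq]
  have hqc : Continuous q := by fun_prop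
  have hxψ := hg.1
  set R : ℝ := 2 * ‖grad f x + g‖ / lam with hR
  have hR0 : 0 ≤ R := by positivity
  obtain ⟨z, -, hzmin⟩ := LowerSemicontinuousOn.exists_isMinOn
    ⟨x, Metric.mem_closedBall_self hR0⟩ (isCompact_closedBall x R)
    ((lowerSemicontinuous_coe_add hψ hqc).lowerSemicontinuousOn _)
  have hzx : (q z : EReal) + ψ z ≤ q x + ψ x := hzmin (Metric.mem_closedBall_self hR0)
  have hzψ : z ∈ effDom ψ := by
    change ψ z < ⊤
    refine Ne.lt_top fun h => ?_
    rw [h, EReal.coe_add_top, top_le_iff, ← hψ.coe_toReal hxψ] at hzx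
    exact EReal.coe_ne_top _ (by exact_mod_cast hzx)
  have hmin : ∀ y ∈ effDom ψ, q z + (ψ z).toReal ≤ q y + (ψ y).toReal := by
    intro y hy
    have hcoe : ∀ y₁ y₂, y₁ ∈ effDom ψ → y₂ ∈ effDom ψ →
        (q y₁ : EReal) + ψ y₁ ≤ q y₂ + ψ y₂ → q y₁ + (ψ y₁).toReal ≤ q y₂ + (ψ y₂).toReal := by
      intro y₁ y₂ h₁ h₂ h
      rw [← hψ.coe_toReal h₁, ← hψ.coe_toReal h₂] at h
      exact_mod_cast h
    by_cases hyR : y ∈ Metric.closedBall x R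
    · exact hcoe z y hzψ hy (hzmin hyR)
    · -- outside the ball, the quadratic term exceeds the linear lower bound given by `g`
      refine (hcoe z x hzψ hxψ hzx).trans ?_
      have h1 : R < ‖y - x‖ := by
        rw [← dist_eq_norm]
        exact not_le.1 hyR
      rw [hR, div_lt_iff₀ hlam] at h1
      have h2 := inner_add_le_of_mem_convexSubdiff hψ hg hy
      have h3 := neg_le_of_abs_le (abs_real_inner_le_norm (grad f x + g) (y - x))
      rw [inner_add_left] at h3
      have h4 := hH (y - x)
      have h5 := mul_le_mul_of_nonneg_right h1.le (norm_nonneg (y - x))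
      rw [hqx]
      simp only [hq]
      nlinarith
  refine ⟨z, frechetSubdiff_subset_convexSubdiff hψ z ⟨hzψ, fun ε hε => ?_⟩, ?_⟩
  · set K : ℝ := ‖H x‖ / 2 + lam / 2 with hK
    have hK0 : 0 < K := by positivity
    filter_upwards [Metric.ball_mem_nhds z (div_pos hε hK0)] with u hu
    by_cases huψ : u ∈ effDom ψ
    swap
    · have : ψ u = ⊤ := not_lt_top_iff.1 huψ
      rw [this]
      exact le_top
    have h1 := hmin u huψ
    have hu' : ‖u - z‖ * K < ε := by
      rw [← lt_div_iff₀ hK0, ← dist_eq_norm]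
      exact hu
    have h2 : ⟪H x (u - z), u - z⟫_ℝ ≤ ‖H x‖ * ‖u - z‖ * ‖u - z‖ :=
      (real_inner_le_norm _ _).trans (by gcongr; exact (H x).le_opNorm _)
    have h3 : q u = q z - ⟪-grad f x - H x (z - x) - lam • (z - x), u - z⟫_ℝ +
        1 / 2 * ⟪H x (u - z), u - z⟫_ℝ + lam / 2 * ‖u - z‖ ^ 2 := by
      have e : u - x = (z - x) + (u - z) := by abel
      simp only [hq]
      rw [e, map_add, norm_add_sq_real]
      simp only [inner_add_left, inner_add_right, inner_sub_left, inner_neg_left,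
        real_inner_smul_left]
      rw [real_inner_comm (u - z) (H x (z - x)), hsymm (u - z) (z - x),
        real_inner_comm (H x (z - x)) (u - z)]
      ring
    have h4 := mul_le_mul_of_nonneg_right hu'.le (norm_nonneg (u - z))
    rw [← hψ.coe_toReal hzψ, ← hψ.coe_toReal huψ]
    have h5 : (ψ z).toReal + (⟪-grad f x - H x (z - x) - lam • (z - x), u - z⟫_ℝ -
        ε * ‖u - z‖) ≤ (ψ u).toReal := by
      rw [hK] at h4
      nlinarith
    exact_mod_cast h5
  · have h := hmin x hxψ
    rw [model, model, ← hf.coe_toReal hxf, ← hψ.coe_toReal hxψ, ← hψ.coe_toReal hzψ]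
    have h' : (f x).toReal + q z + (ψ z).toReal ≤ (f x).toReal + q x + (ψ x).toReal := by linarith
    exact_mod_cast h'

end ConvexModel

/-! ### Runs of the method -/

section Run

variable {E : Type*} [NormedAddCommGroup E] [InnerProductSpace ℝ E] [CompleteSpace E]
  {f ψ : E → EReal} {H : E → E →L[ℝ] E} {L α β m : ℝ} {x : ℕ → E} {lam Lam : ℕ → ℝ} {j : ℕ → ℕ}

theorem IsRun.Lam_pos (hrun : IsRun f ψ H α β m x lam Lam j) (k : ℕ) : 0 < Lam k := by
  induction k with
  | zero => exact hrun.Lam_zero_pos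
  | succ k ih =>
    rw [hrun.Lam_succ, hrun.lam_eq]
    positivity

theorem IsRun.lam_pos (hrun : IsRun f ψ H α β m x lam Lam j) (k : ℕ) : 0 < lam k := by
  rw [hrun.lam_eq]
  have := hrun.Lam_pos k
  positivity

theorem IsRun.half_lam_le (hrun : IsRun f ψ H α β m x lam Lam j) (k : ℕ) :
    lam k / 2 ≤ lam (k + 1) := by
  rw [hrun.lam_eq (k + 1), hrun.Lam_succ]
  have := hrun.lam_pos k
  exact le_mul_of_one_le_left (by positivity) (one_le_pow₀ one_le_two)

theorem IsRun.mem_effDom (hrun : IsRun f ψ H α β m x lam Lam j) (k : ℕ) :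
    x k ∈ effDom (objective f ψ) := by
  induction k with
  | zero => exact hrun.start_mem
  | succ k ih =>
    change objective f ψ (x (k + 1)) < ⊤
    refine Ne.lt_top fun h => ?_
    have h1 := (hrun.accepted k).decrease_cond
    rw [h, EReal.top_add_coe, top_le_iff] at h1
    exact ne_of_lt ih h1

/-- If trial points exist and are accepted once `lam ≥ B`, the line search keeps the accepted
parameters bounded. -/
theorem IsRun.exists_lam_le (hrun : IsRun f ψ H α β m x lam Lam j) {B : ℝ}
    (hB : ∀ᶠ k in atTop, ∀ t, B ≤ t → (∃ z, IsTrialPoint f ψ H t (x k) z) ∧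
      ∀ z, IsTrialPoint f ψ H t (x k) z → Accepted f ψ H α β t (x k) z) :
    ∃ B' : ℝ, ∀ᶠ k in atTop, lam k ≤ B' := by
  obtain ⟨K, hK⟩ := eventually_atTop.1 hB
  refine ⟨max (lam K) (2 * B), eventually_atTop.2 ⟨K, fun k hk => ?_⟩⟩
  induction k, hk using Nat.le_induction with
  | base => exact le_max_left _ _
  | succ k hk ih =>
    rcases hj : j (k + 1) with _ | i
    · have h1 := hrun.lam_eq (k + 1)
      rw [hj, pow_zero, one_mul, hrun.Lam_succ] at h1
      linarith [hrun.lam_pos k]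
    · have hlt : 2 ^ i * Lam (k + 1) < B := by
        by_contra! hcon
        obtain ⟨h1, h2⟩ := hK (k + 1) (by omega) _ hcon
        rcases hrun.rejected (k + 1) i (by omega) with h | ⟨z, hz, hz'⟩
        · exact h h1
        · exact hz' (h2 z hz)
      have h1 := hrun.lam_eq (k + 1)
      rw [hj, pow_succ] at h1
      refine le_max_of_le_right ?_
      linarith

/-- Near a critical point the accepted parameters are bounded. -/
theorem IsRun.exists_lam_le_of_tendsto (hf : SmoothOnDom f) (hψ : ProperConvexLsc ψ)
    (hmain : MainInequality f H L) (hsub : SubproblemSolvable f ψ H L)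
    (hrun : IsRun f ψ H α β m x lam Lam j) {xs : E} (hx : Tendsto x atTop (𝓝 xs))
    (hxs : xs ∈ effDom f) (h₀ : -grad f xs ∈ convexSubdiff ψ xs) :
    ∃ B : ℝ, ∀ᶠ k in atTop, lam k ≤ B := by
  obtain ⟨B, hB⟩ := eventually_forall_accepted hf hψ hmain hrun.alpha_le hrun.one_le_m
    hrun.beta_le hxs h₀
  refine hrun.exists_lam_le (B := max B L) ?_
  filter_upwards [hx.eventually hB] with k hk t ht
  exact ⟨hsub t ((le_max_right _ _).trans ht) _ (hrun.mem_effDom k),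
    hk ((mem_effDom_objective hf hψ).1 (hrun.mem_effDom k)).2 t ((le_max_left _ _).trans ht)⟩

/-- The first acceptance condition makes the new subgradient small relative to the parameter. -/
theorem IsRun.norm_trialSubgrad_le (hrun : IsRun f ψ H α β m x lam Lam j) (k : ℕ) :
    α * ‖trialSubgrad f H (lam k) (x k) (x (k + 1))‖ ≤ lam k * ‖x (k + 1) - x k‖ := by
  have h := (hrun.accepted k).subgrad_cond
  have h1 := real_inner_le_norm (trialSubgrad f H (lam k) (x k) (x (k + 1))) (x k - x (k + 1))
  rw [norm_sub_rev] at h1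
  have hl := hrun.lam_pos k
  rw [div_mul_eq_mul_div, div_le_iff₀ hl] at h
  set s := ‖trialSubgrad f H (lam k) (x k) (x (k + 1))‖ with hs
  rcases eq_or_lt_of_le (show 0 ≤ s from norm_nonneg _) with h0 | h0
  · rw [← h0, mul_zero]
    positivity
  · refine le_of_mul_le_mul_right ?_ h0
    nlinarith

/-- With a positive semidefinite operator, the step to a trial point for half of the accepted
parameter is at most a fixed multiple of the previous step, even if the parameters tend to zero. -/
theorem IsRun.norm_sub_le_of_half (hψ : ProperConvexLsc ψ)
    (hrun : IsRun f ψ H α β m x lam Lam j) {k : ℕ} (hH : ∀ d : E, 0 ≤ ⟪H (x (k + 1)) d, d⟫_ℝ)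
    {z : E} (hz : IsTrialPoint f ψ H (lam (k + 1) / 2) (x (k + 1)) z) :
    ‖z - x (k + 1)‖ ≤ 4 / α * ‖x (k + 1) - x k‖ := by
  have h1 := hz.mul_norm_sub_le hψ hH (hrun.trial k).first_order
  have h2 : α * _ ≤ _ := hrun.norm_trialSubgrad_le k
  have hα := hrun.alpha_pos
  have hl := hrun.lam_pos k
  have h3 : lam k / 4 * ‖z - x (k + 1)‖ ≤ lam (k + 1) / 2 * ‖z - x (k + 1)‖ :=
    mul_le_mul_of_nonneg_right (by linarith [hrun.half_lam_le k]) (norm_nonneg _)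
  have h4 := mul_le_mul_of_nonneg_left (h3.trans h1) hα.le
  rw [div_mul_eq_mul_div, le_div_iff₀ hα]
  refine le_of_mul_le_mul_left ?_ hl
  have h5 := h4.trans h2
  linarith

end Run

end LeAPSSN

/-! ### Finite time identification -/

theorem proposition6p16
    {E : Type*} [NormedAddCommGroup E] [InnerProductSpace ℝ E] [FiniteDimensional ℝ E]
    [CompleteSpace E]
    (f ψ : E → EReal) (H : E → E →L[ℝ] E) (L : ℝ)
    (hf : LeAPSSN.SmoothOnDom f) (hψ : LeAPSSN.ProperConvexLsc ψ)
    (hmain : LeAPSSN.MainInequality f H L) (hsub : LeAPSSN.SubproblemSolvable f ψ H L)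
    (α β m : ℝ) (x : ℕ → E) (lam Lam : ℕ → ℝ) (j : ℕ → ℕ)
    (hrun : LeAPSSN.IsRun f ψ H α β m x lam Lam j)
    (xs : E) (hmin : ∀ y, LeAPSSN.objective f ψ xs ≤ LeAPSSN.objective f ψ y)
    (hx : Tendsto x atTop (𝓝 xs))
    (hFx : Tendsto (fun k => LeAPSSN.objective f ψ (x k)) atTop (𝓝 (LeAPSSN.objective f ψ xs)))
    (M : Set E) (hM : LeAPSSN.PartlySmoothAt (LeAPSSN.objective f ψ) M xs)
    (hnondeg : (0 : E) ∈ intrinsicInterior ℝ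
      (LeAPSSN.limitingSubdiff (LeAPSSN.objective f ψ) xs)) :
    (∀ᶠ k in atTop, x k ∈ M) ∧
    ((∀ᶠ k in atTop, ∀ d : E, 0 ≤ ⟪H (x k) d, d⟫_ℝ) →
      (∃ μ : ℝ, 0 < μ ∧ LeAPSSN.PLCondition (LeAPSSN.objective f ψ) μ) →
      (∃ R : ℝ, 0 < R ∧
        (∃ L₁ : ℝ≥0, LipschitzOnWith L₁ (LeAPSSN.grad f)
          (Metric.ball xs R ∩ LeAPSSN.effDom f)) ∧
        (∃ C : ℝ, ∀ y ∈ Metric.closedBall xs R ∩ LeAPSSN.effDom f, ‖H y‖ ≤ C)) →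
      ∀ᶠ k in atTop,
        (∃ z, LeAPSSN.IsTrialPoint f ψ H (lam k / 2) (x k) z) ∧
        ∀ z, LeAPSSN.IsTrialPoint f ψ H (lam k / 2) (x k) z → z ∈ M) := by
  have h0 := intrinsicInterior_subset hnondeg
  have hxsf := ((LeAPSSN.mem_effDom_objective hf hψ).1 h0.1).1
  have hcrit : -LeAPSSN.grad f xs ∈ LeAPSSN.convexSubdiff ψ xs := by
    simpa using LeAPSSN.sub_grad_mem_convexSubdiff hf hψ h0
  have hxf : ∀ k, x k ∈ LeAPSSN.effDom f := fun k =>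
    ((LeAPSSN.mem_effDom_objective hf hψ).1 (hrun.mem_effDom k)).1
  obtain ⟨δ, hδ, hident⟩ := LeAPSSN.exists_identification_radius hf hψ hM hnondeg
  obtain ⟨B, hB⟩ := hrun.exists_lam_le_of_tendsto hf hψ hmain hsub hx hxsf hcrit
  have hx1 : Tendsto (fun k => x (k + 1)) atTop (𝓝 xs) := hx.comp (tendsto_add_atTop_nat 1)
  have hstep : Tendsto (fun k => ‖x (k + 1) - x k‖) atTop (𝓝 0) := by
    simpa using (hx1.sub hx).norm
  have hdist : Tendsto (fun k => ‖x (k + 1) - xs‖) atTop (𝓝 0) :=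
    tendsto_iff_norm_sub_tendsto_zero.1 hx1
  constructor
  · -- both conclusions are proved for `k + 1`, which has the step from `k` behind it
    have hlim : Tendsto (fun k => (L + B) * ‖x (k + 1) - x k‖) atTop (𝓝 0) := by
      simpa using hstep.const_mul (L + B)
    rw [← map_add_atTop_eq_nat 1, eventually_map]
    filter_upwards [hB, hlim.eventually (gt_mem_nhds hδ), hdist.eventually (gt_mem_nhds hδ)]
      with k hk1 hk2 hk3
    refine hident _ _ hk3 (hrun.trial k).first_order (lt_of_le_of_lt
      (LeAPSSN.norm_trialSubgrad_le hmain (hrun.lam_pos k).le (hxf k) (hxf (k + 1)))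
      (lt_of_le_of_lt ?_ hk2))
    gcongr
  · intro hpsd _ _
    obtain ⟨r, hr, hball⟩ := Metric.isOpen_iff.1 hf.isOpen xs hxsf
    have hstep' : Tendsto (fun k => 4 / α * ‖x (k + 1) - x k‖) atTop (𝓝 0) := by
      simpa using hstep.const_mul (4 / α)
    have hlim : Tendsto (fun k => (L + B) * (4 / α * ‖x (k + 1) - x k‖)) atTop (𝓝 0) := by
      simpa using hstep'.const_mul (L + B)
    have hlim2 : Tendsto (fun k => 4 / α * ‖x (k + 1) - x k‖ + ‖x (k + 1) - xs‖)
        atTop (𝓝 0) := by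
      simpa using hstep'.add hdist
    have hB1 := (tendsto_add_atTop_nat 1).eventually hB
    have hpsd1 := (tendsto_add_atTop_nat 1).eventually hpsd
    rw [← map_add_atTop_eq_nat 1, eventually_map]
    filter_upwards [hB1, hpsd1, hlim.eventually (gt_mem_nhds hδ),
      hlim2.eventually (gt_mem_nhds (lt_min hδ hr))] with k hk1 hk2 hk3 hk4
    have hl : 0 < lam (k + 1) / 2 := half_pos (hrun.lam_pos (k + 1))
    refine ⟨LeAPSSN.exists_isTrialPoint hf hψ hl (hxf (k + 1)) (hmain.2.1 _ (hxf (k + 1))) hk2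
      (hrun.trial k).first_order, fun z hz => ?_⟩
    have h1 := hrun.norm_sub_le_of_half hψ hk2 hz
    have h2 : ‖z - xs‖ < min δ r := by
      refine lt_of_le_of_lt ?_ hk4
      calc ‖z - xs‖ = ‖(z - x (k + 1)) + (x (k + 1) - xs)‖ := by congr 1; abel
        _ ≤ ‖z - x (k + 1)‖ + ‖x (k + 1) - xs‖ := norm_add_le _ _
        _ ≤ _ := by gcongr
    have hzf : z ∈ LeAPSSN.effDom f := hball (by
      rw [Metric.mem_ball, dist_eq_norm]
      exact h2.trans_le (min_le_right _ _))
    refine hident z _ (h2.trans_le (min_le_left _ _)) hz.first_order (lt_of_le_of_lt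
      (LeAPSSN.norm_trialSubgrad_le hmain hl.le (hxf (k + 1)) hzf) (lt_of_le_of_lt ?_ hk3))
    have hL := hmain.1
    have h3 : L + lam (k + 1) / 2 ≤ L + B := by linarith
    exact mul_le_mul h3 h1 (norm_nonneg _) (by linarith)
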